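/- Let $T$ be the rooted binary tree whose vertices are the finite words over $\{0,1\}$, and let $W$ be its automorphism group with the profinite topology. For $u,v\in W$ let $(u,v)\in W$ denote the automorphism fixing both vertices of level $1$ and acting as $u$ and $v$ on the subtrees below $0$ and $1$ (each identified with $T$), and let $\sigma\in W$ be the automorphism that interchanges these two subtrees. Write $x\sim y$ if $x,y$ are conjugate under $W$. Fix an integer $r\ge1$, let $a_i$ ($i\ge1$) and $b_j$ ($1\le j\le r$) be the unique elements of $W$ satisfying $$a_1=\sigma,\quad a_{r+1}=(a_r,b_r),\quad a_i=(a_{i-1},1)\ \ (i>1,\ i\ne r+1),$$ $$b_1=(b_r,b_r^{-1})\,\sigma,\quad b_j=(b_rb_{j-1}b_r^{-1},1)\ \ (1<j\le r),$$ and let $G(r)$ be the closure of the subgroup of $W$ generated by all these $a_i$ and $b_j$. **Theorem.** Let $a'_i$ ($i\ge1$) and $b'_j$ ($1\le j\le r$) be elements of $W$ such that (a) $a'_1\sim\sigma$; $a'_{r+1}\sim(a'_r,b'_r)$; $a'_i\sim(a'_{i-1},1)$ for all $i>1$ with $i\ne r+1$; $b'_1\sim\sigma$; $b'_j\sim(b'_{j-1},1)$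 for all $1<j\le r$; and (b) the infinite product of all $a'_i$ and $b'_j$ in some order converges to $1\in W$; that is, for some total order on the set of indices the products over finite sets of indices, taken in this order, converge to $1$ along the directed set of finite sets of indices. Then there exists $w\in W$ such that for all $i\ge1$ and all $1\le j\le r$, the element $w^{-1}a'_iw$ is conjugate to $a_i$ under $G(r)$ and $w^{-1}b'_jw$ is conjugate to $b_j$ under $G(r)$. Moreover, for any such $w$, the closure of the subgroup of $W$ generated by all $a'_i$ and $b'_j$ is $wG(r)w^{-1}$. -/

import Mathlib

/-! The regular rooted binary tree `T` has the finite words over `Bool` as vertices, the empty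
word as root, and the words extending `x` as the descendants of `x`. -/

namespace BinaryTree

open Filter Topology

/-- The group `W` of automorphisms of the rooted binary tree `T`: the bijections of the set of
finite words that preserve the relation "being a prefix of" in both directions. The group law is
composition, `(g * h) x = g (h x)`. -/
abbrev W : Type :=
  ((fun x y : List Bool => x <+: y) ≃r (fun x y : List Bool => x <+: y))

/-- The profinite topology on `W`: pointwise convergence, the set of vertices being discrete. -/
instance instTopologicalSpaceW : TopologicalSpace W :=
  TopologicalSpace.induced (fun (g : W) (x : List Bool) => g x)
    (@Pi.topologicalSpace (List Bool) (fun _ => List Bool) (fun _ => ⊥))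

theorem prefix_iff (g : W) (x y : List Bool) : g x <+: g y ↔ x <+: y := g.map_rel_iff

theorem length_le_length_apply (g : W) (x : List Bool) : x.length ≤ (g x).length := by
  induction x using List.reverseRecOn with
  | nil => simp
  | append_singleton l b ih =>
    have h1 : g l <+: g (l ++ [b]) := (prefix_iff g _ _).2 (List.prefix_append l [b])
    have h2 : (g l).length ≠ (g (l ++ [b])).length := by
      intro h
      have h3 := g.injective (h1.eq_of_length h)
      simp at h3
    have h4 := h1.length_le
    simp only [List.length_append, List.length_singleton]
    omega

/-- Automorphisms preserve the levels of the tree. -/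
theorem length_apply (g : W) (x : List Bool) : (g x).length = x.length := by
  apply le_antisymm _ (length_le_length_apply g x)
  have h := length_le_length_apply g⁻¹ (g x)
  rwa [RelIso.inv_apply_self] at h

theorem apply_nil (g : W) : g [] = [] :=
  List.eq_nil_of_length_eq_zero (by simp [length_apply])

theorem isOpen_apply_eq (x y : List Bool) : IsOpen {g : W | g x = y} := by
  let _ : TopologicalSpace (List Bool) := ⊥
  have : DiscreteTopology (List Bool) := ⟨rfl⟩
  have hc : Continuous (fun g : W => g x) :=
    (continuous_apply x).comp (continuous_induced_dom (f := fun (g : W) (x : List Bool) => g x))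
  exact (isOpen_discrete ({y} : Set (List Bool))).preimage hc

theorem continuous_W {X : Type*} [TopologicalSpace X] (F : X → W)
    (h : ∀ x y, IsOpen {t : X | F t x = y}) : Continuous F := by
  let _ : TopologicalSpace (List Bool) := ⊥
  have : DiscreteTopology (List Bool) := ⟨rfl⟩
  refine continuous_induced_rng.2 (continuous_pi fun x => ?_)
  rw [continuous_discrete_rng]
  intro y
  exact h x y

instance instIsTopologicalGroupW : IsTopologicalGroup W where
  continuous_mul := by
    refine continuous_W _ fun x y => ?_
    have h : {t : W × W | (t.1 * t.2) x = y} =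
        ⋃ z : List Bool, {g : W | g z = y} ×ˢ {g : W | g x = z} := by
      ext t
      simp [RelIso.mul_apply]
    rw [h]
    exact isOpen_iUnion fun z => (isOpen_apply_eq z y).prod (isOpen_apply_eq x z)
  continuous_inv := by
    refine continuous_W _ fun x y => ?_
    have h : {t : W | t⁻¹ x = y} = {t : W | t y = x} := by
      ext t
      constructor
      · rintro rfl
        exact RelIso.apply_inv_self t x
      · rintro rfl
        exact RelIso.inv_apply_self t y
    rw [h]
    exact isOpen_apply_eq y x

/-- The underlying map of `(u, v)`: it acts by `u` on the subtree below the vertex `0` and by `v`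
on the subtree below the vertex `1`. -/
def pairFun (u v : W) : List Bool → List Bool
  | [] => []
  | false :: x => false :: u x
  | true :: x => true :: v x

/-- The element `(u, v)` of `W × W ⊆ W`. -/
def pair (u v : W) : W where
  toFun := pairFun u v
  invFun := pairFun u⁻¹ v⁻¹
  left_inv x := by
    match x with
    | [] => rfl
    | false :: x => simp [pairFun]
    | true :: x => simp [pairFun]
  right_inv x := by
    match x with
    | [] => rfl
    | false :: x => simp [pairFun]
    | true :: x => simp [pairFun]
  map_rel_iff' {x y} := by
    match x, y with
    | [], _ => simp [pairFun]
    | false :: x, [] => simp [pairFun]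
    | true :: x, [] => simp [pairFun]
    | false :: x, false :: y => simp [pairFun, List.cons_prefix_cons, prefix_iff]
    | false :: x, true :: y => simp [pairFun, List.cons_prefix_cons]
    | true :: x, false :: y => simp [pairFun, List.cons_prefix_cons]
    | true :: x, true :: y => simp [pairFun, List.cons_prefix_cons, prefix_iff]

/-- The underlying map of `σ`. -/
def swapFun : List Bool → List Bool
  | [] => []
  | b :: x => (!b) :: x

/-- The element `σ` of `W` of order two that interchanges the two subtrees below the root. -/
def σ : W where
  toFun := swapFun
  invFun := swapFun
  left_inv x := by cases x <;> simp [swapFun]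
  right_inv x := by cases x <;> simp [swapFun]
  map_rel_iff' {x y} := by
    cases x <;> cases y <;> simp [swapFun, List.cons_prefix_cons]

/-- The recursion relations that define the standard generators `a i` for `i ≥ 1` and `b j` for
`1 ≤ j ≤ r`. The values `a 0`, `b 0` and `b j` for `j > r` play no role. -/
structure IsStandard (r : ℕ) (a b : ℕ → W) : Prop where
  a_one : a 1 = σ
  a_special : a (r + 1) = pair (a r) (b r)
  a_other : ∀ i, 1 < i → i ≠ r + 1 → a i = pair (a (i - 1)) 1
  b_one : b 1 = pair (b r) (b r)⁻¹ * σ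
  b_other : ∀ j, 1 < j → j ≤ r → b j = pair (b r * b (j - 1) * (b r)⁻¹) 1

/-! The rest of this section shows that the recursion relations determine the generators. -/

/-- `g` and `h` act in the same way on the tree truncated at level `n`. -/
def Agree (n : ℕ) (g h : W) : Prop := ∀ x : List Bool, x.length ≤ n → g x = h x

theorem agree_mul {n : ℕ} {g g' h h' : W} (h1 : Agree n g g') (h2 : Agree n h h') :
    Agree n (g * h) (g' * h') := by
  intro x hx
  rw [RelIso.mul_apply, RelIso.mul_apply, h2 x hx]
  exact h1 _ (by rwa [length_apply])

theorem agree_inv {n : ℕ} {g g' : W} (h : Agree n g g') : Agree n g⁻¹ g'⁻¹ := by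
  intro x hx
  apply g.injective
  rw [RelIso.apply_inv_self, h _ (by rwa [length_apply]), RelIso.apply_inv_self]

theorem agree_pair {n : ℕ} {u u' v v' : W} (h1 : Agree n u u') (h2 : Agree n v v') :
    Agree (n + 1) (pair u v) (pair u' v') := by
  intro x hx
  match x with
  | [] => rfl
  | false :: x => exact congrArg (List.cons false) (h1 x (by simpa using hx))
  | true :: x => exact congrArg (List.cons true) (h2 x (by simpa using hx))

theorem agree_zero (g h : W) : Agree 0 g h := by
  intro x hx
  obtain rfl : x = [] := List.eq_nil_of_length_eq_zero (by omega)
  rw [apply_nil, apply_nil]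

theorem agree_refl (n : ℕ) (g : W) : Agree n g g := fun _ _ => rfl

/-- The limit of a coherent sequence of automorphisms. -/
def limit (s : ℕ → W) (hs : ∀ n, Agree n (s n) (s (n + 1))) : W :=
  have coh : ∀ (x : List Bool) (N : ℕ), x.length ≤ N → s x.length x = s N x := by
    intro x N hN
    induction N, hN using Nat.le_induction with
    | base => rfl
    | succ N hN ih => rw [ih]; exact hs N x hN
  { toFun := fun x => s x.length x
    invFun := fun x => (s x.length)⁻¹ x
    left_inv := fun x => by simp [length_apply]
    right_inv := fun x => by simp [length_apply]
    map_rel_iff' := fun {x y} => by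
      change s x.length x <+: s y.length y ↔ x <+: y
      rw [coh x _ (le_max_left x.length y.length), coh y _ (le_max_right x.length y.length),
        prefix_iff] }

theorem agree_limit (s : ℕ → W) (hs : ∀ n, Agree n (s n) (s (n + 1))) (n : ℕ) :
    Agree n (limit s hs) (s n) := by
  intro x hx
  change s x.length x = s n x
  induction n, hx using Nat.le_induction with
  | base => rfl
  | succ N hN ih => rw [ih]; exact hs N x hN

/-- The right hand sides of the recursion relations. -/
def step (r : ℕ) (p : (ℕ → W) × (ℕ → W)) : (ℕ → W) × (ℕ → W) :=
  (fun i => if i = 1 then σ else if i = r + 1 then pair (p.1 r) (p.2 r) else pair (p.1 (i - 1)) 1,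
   fun j => if j = 1 then pair (p.2 r) (p.2 r)⁻¹ * σ
     else pair (p.2 r * p.2 (j - 1) * (p.2 r)⁻¹) 1)

theorem agree_step (r n : ℕ) {p q : (ℕ → W) × (ℕ → W)} (h1 : ∀ i, Agree n (p.1 i) (q.1 i))
    (h2 : ∀ j, Agree n (p.2 j) (q.2 j)) :
    (∀ i, Agree (n + 1) ((step r p).1 i) ((step r q).1 i)) ∧
      ∀ j, Agree (n + 1) ((step r p).2 j) ((step r q).2 j) := by
  constructor
  · intro i
    simp only [step]
    split_ifs
    · exact agree_refl _ _
    · exact agree_pair (h1 r) (h2 r)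
    · exact agree_pair (h1 _) (agree_refl _ _)
  · intro j
    simp only [step]
    split_ifs
    · exact agree_mul (agree_pair (h2 r) (agree_inv (h2 r))) (agree_refl _ _)
    · exact agree_pair (agree_mul (agree_mul (h2 r) (h2 _)) (agree_inv (h2 r))) (agree_refl _ _)

theorem agree_iterate (r n : ℕ) :
    (∀ i, Agree n (((step r)^[n] 1).1 i) (((step r)^[n + 1] 1).1 i)) ∧
      ∀ j, Agree n (((step r)^[n] 1).2 j) (((step r)^[n + 1] 1).2 j) := by
  induction n with
  | zero => exact ⟨fun _ => agree_zero _ _, fun _ => agree_zero _ _⟩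
  | succ n ih =>
    rw [Function.iterate_succ_apply' (step r) n, Function.iterate_succ_apply' (step r) (n + 1)]
    exact agree_step r n ih.1 ih.2

theorem exists_isStandard (r : ℕ) (hr : 1 ≤ r) :
    ∃ p : (ℕ → W) × (ℕ → W), IsStandard r p.1 p.2 := by
  let p : (ℕ → W) × (ℕ → W) :=
    (fun i => limit (fun n => ((step r)^[n] 1).1 i) fun n => (agree_iterate r n).1 i,
     fun j => limit (fun n => ((step r)^[n] 1).2 j) fun n => (agree_iterate r n).2 j)
  have hp1 : ∀ n i, Agree n (p.1 i) (((step r)^[n] 1).1 i) := fun n i => agree_limit _ _ n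
  have hp2 : ∀ n j, Agree n (p.2 j) (((step r)^[n] 1).2 j) := fun n j => agree_limit _ _ n
  have key : step r p = p := by
    have hs := fun n => agree_step r n (hp1 n) (hp2 n)
    simp only [← Function.iterate_succ_apply' (step r)] at hs
    refine Prod.ext (funext fun i => RelIso.ext fun x => ?_)
      (funext fun j => RelIso.ext fun x => ?_)
    · rw [(hs x.length).1 i x (by omega), hp1 (x.length + 1) i x (by omega)]
    · rw [(hs x.length).2 j x (by omega), hp2 (x.length + 1) j x (by omega)]
  have k1 : ∀ i, p.1 i = (step r p).1 i := fun i => by rw [key]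
  have k2 : ∀ j, p.2 j = (step r p).2 j := fun j => by rw [key]
  refine ⟨p, ?_, ?_, ?_, ?_, ?_⟩
  · rw [k1]; simp [step]
  · rw [k1]; simp [step, show r ≠ 0 by omega]
  · intro i hi hir
    rw [k1]
    simp [step, hir, show i ≠ 1 by omega]
  · rw [k2]; simp [step]
  · intro j hj _
    rw [k2]
    simp [step, show j ≠ 1 by omega]

/-- The recursion relations have at most one solution in the relevant range of indices. -/
theorem IsStandard.unique {r : ℕ} {a b a' b' : ℕ → W} (h : IsStandard r a b)
    (h' : IsStandard r a' b') (hr : 1 ≤ r) :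
    (∀ i, 1 ≤ i → a i = a' i) ∧ ∀ j, 1 ≤ j → j ≤ r → b j = b' j := by
  have key : ∀ n, (∀ i, 1 ≤ i → Agree n (a i) (a' i)) ∧
      ∀ j, 1 ≤ j → j ≤ r → Agree n (b j) (b' j) := by
    intro n
    induction n with
    | zero => exact ⟨fun _ _ => agree_zero _ _, fun _ _ _ => agree_zero _ _⟩
    | succ n ih =>
      have hbr := ih.2 r hr le_rfl
      constructor
      · intro i hi
        rcases eq_or_ne i 1 with rfl | h1
        · rw [h.a_one, h'.a_one]; exact agree_refl _ _
        rcases eq_or_ne i (r + 1) with rfl | h2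
        · rw [h.a_special, h'.a_special]; exact agree_pair (ih.1 r hr) hbr
        · rw [h.a_other i (by omega) h2, h'.a_other i (by omega) h2]
          exact agree_pair (ih.1 _ (by omega)) (agree_refl _ _)
      · intro j hj hjr
        rcases eq_or_ne j 1 with rfl | h1
        · rw [h.b_one, h'.b_one]
          exact agree_mul (agree_pair hbr (agree_inv hbr)) (agree_refl _ _)
        · rw [h.b_other j (by omega) hjr, h'.b_other j (by omega) hjr]
          exact agree_pair (agree_mul (agree_mul hbr (ih.2 _ (by omega) (by omega)))
            (agree_inv hbr)) (agree_refl _ _)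
  exact ⟨fun i hi => RelIso.ext fun x => (key x.length).1 i hi x le_rfl,
    fun j hj hjr => RelIso.ext fun x => (key x.length).2 j hj hjr x le_rfl⟩

/-- The standard generators, as the pair of families `(a, b)`. -/
noncomputable def stdGen (r : ℕ) (hr : 1 ≤ r) : (ℕ → W) × (ℕ → W) :=
  (exists_isStandard r hr).choose

/-- The standard generator `a_i`, for `i ≥ 1`. -/
noncomputable def stdA (r : ℕ) (hr : 1 ≤ r) (i : ℕ) : W := (stdGen r hr).1 i

/-- The standard generator `b_j`, for `1 ≤ j ≤ r`. -/
noncomputable def stdB (r : ℕ) (hr : 1 ≤ r) (j : ℕ) : W := (stdGen r hr).2 j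

theorem isStandard_std (r : ℕ) (hr : 1 ≤ r) : IsStandard r (stdA r hr) (stdB r hr) :=
  (exists_isStandard r hr).choose_spec

/-- The closure in `W` of the subgroup generated by all `a i` for `i ≥ 1` and all `b j` for
`1 ≤ j ≤ r`. -/
def closedSubgroupGen (r : ℕ) (a b : ℕ → W) : Subgroup W :=
  (Subgroup.closure ({g | ∃ i, 1 ≤ i ∧ g = a i} ∪
    {g | ∃ j, 1 ≤ j ∧ j ≤ r ∧ g = b j})).topologicalClosure

/-- The group `G(r)`. -/
noncomputable def G (r : ℕ) (hr : 1 ≤ r) : Subgroup W :=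
  closedSubgroupGen r (stdA r hr) (stdB r hr)

/-- `x` and `y` are conjugate under the subgroup `H`. -/
def ConjUnder (H : Subgroup W) (x y : W) : Prop := ∃ g ∈ H, g * x * g⁻¹ = y

/-- The index set of the generators: one index for every `a_i` with `i ≥ 1` and one for every
`b_j` with `1 ≤ j ≤ r`. -/
inductive GenIndex (r : ℕ) : Type
  | a (i : ℕ) (hi : 1 ≤ i) : GenIndex r
  | b (j : ℕ) (hj : 1 ≤ j) (hjr : j ≤ r) : GenIndex r

/-- The family consisting of all `a i` for `i ≥ 1` and all `b j` for `1 ≤ j ≤ r`. -/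
def genFamily (r : ℕ) (a b : ℕ → W) : GenIndex r → W
  | .a i _ => a i
  | .b j _ _ => b j

/-- The product of the family `f`, taken in the order of the linearly ordered index set `ι`,
converges to `m`: the products over the finite subsets of `ι`, each taken in the given order,
converge to `m` along the directed set of finite subsets. -/
def HasOrderedProd {ι M : Type*} [Monoid M] [TopologicalSpace M] (ord : LinearOrder ι)
    (f : ι → M) (m : M) : Prop :=
  Tendsto (fun F : Finset ι => ((F.sort (fun x y => x ≤ y)).map f).prod) atTop (𝓝 m)

end BinaryTree

namespace BinaryTree

open Filter Topology

/-! ### Pairs and the swap -/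

/-! Existence goes by induction on the level, then compactness. Call $x$ a child of $y$ if the
generator $x$ enters the recursion of $y$; every index has exactly one parent. After conjugating so
that $a'_1=\sigma$ and rotating cyclically, the product relation reads $\sigma\,P\,b'_1\,Q=1$ up to
level $n+1$, with $b'_1=(e,e^{-1})\sigma$ and every factor of $P$ and $Q$ a pair of conjugates of
its children. Comparing components gives $Q_0P_1=e$ and $Q_1P_0=e^{-1}$ up to level $n$. So the
children, taken in the order $Q_0P_1Q_1P_0$, form a family with the same conjugacy relations and
trivial product, and induction supplies a conjugator $w$. The diagonal element $(w,w)$ then works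
one level higher (`exists_isLevelConjugator_succ`): it commutes with $\sigma$, and the other
generators are treated inside $G(r)$.

The obstacle is that $(g,h)$ need not lie in $G(r)$ for $g,h\in G(r)$. The defect has order at most
two and is measured by $b_r$: $(g,h)$ or $(g,b_rh)$ lies in $G(r)$ (`pair_mem_or`). The extra $b_r$
is harmless for pairs, whose second standard entry is $1$ or $b_r$. For $b_1$ it must be computed:
among the factors of $e$ exactly one of $a_r,b_r$ occurs, which gives $(e,b_r)\in G(r)$ after
conjugation by $w$, and this is what makes $(e,e^{-1})\sigma$ conjugate to $b_1$
(`exists_agree_std_β`).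

For the generated group, every finite level is a 2-group, where replacing generators by conjugates
within the group does not change what they generate (`topologicalClosure_closure_conj`). -/

theorem pair_apply_false (u v : W) (x : List Bool) : pair u v (false :: x) = false :: u x := rfl

theorem pair_apply_true (u v : W) (x : List Bool) : pair u v (true :: x) = true :: v x := rfl

theorem pair_mul (u v u' v' : W) : pair u v * pair u' v' = pair (u * u') (v * v') := by
  ext1 x
  match x with
  | [] => rw [apply_nil, apply_nil]
  | false :: x => rfl
  | true :: x => rfl

theorem pair_one : pair 1 1 = 1 := by
  ext1 x
  match x with
  | [] => rfl
  | false :: x => rfl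
  | true :: x => rfl

theorem pair_inv (u v : W) : (pair u v)⁻¹ = pair u⁻¹ v⁻¹ := by
  rw [inv_eq_iff_mul_eq_one, pair_mul, mul_inv_cancel, mul_inv_cancel, pair_one]

theorem σ_mul_σ : σ * σ = 1 := by
  ext1 x
  match x with
  | [] => rfl
  | false :: x => rfl
  | true :: x => rfl

theorem σ_inv : σ⁻¹ = σ := inv_eq_of_mul_eq_one_left σ_mul_σ

theorem σ_mul_pair (u v : W) : σ * pair u v = pair v u * σ := by
  ext1 x
  match x with
  | [] => rfl
  | false :: x => rfl
  | true :: x => rfl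

theorem σ_mul_pair_mul_σ (u v : W) : σ * pair u v * σ = pair v u := by
  rw [σ_mul_pair, mul_assoc, σ_mul_σ, mul_one]

theorem apply_cons_eq_cons_tail {g : W} {b : Bool} (hb : g [b] = [b]) (x : List Bool) :
    g (b :: x) = b :: (g (b :: x)).tail := by
  have h : g [b] <+: g (b :: x) := (prefix_iff g _ _).2 (by simp)
  rw [hb] at h
  obtain ⟨y, hy⟩ := h
  rw [← hy]
  rfl

/-- The automorphism that `g` induces on the subtree below a fixed vertex of level one. -/
def restrict (g : W) (b : Bool) (hb : g [b] = [b]) : W :=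
  have hb' : g⁻¹ [b] = [b] := by
    apply g.injective
    rw [RelIso.apply_inv_self, hb]
  { toFun := fun x => (g (b :: x)).tail
    invFun := fun x => (g⁻¹ (b :: x)).tail
    left_inv := fun x => by
      beta_reduce
      rw [← apply_cons_eq_cons_tail hb, RelIso.inv_apply_self, List.tail_cons]
    right_inv := fun x => by
      beta_reduce
      rw [← apply_cons_eq_cons_tail hb', RelIso.apply_inv_self, List.tail_cons]
    map_rel_iff' := fun {x y} => by
      have h := prefix_iff g (b :: x) (b :: y)
      rw [apply_cons_eq_cons_tail hb x, apply_cons_eq_cons_tail hb y] at h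
      simpa [List.cons_prefix_cons] using h }

theorem eq_pair_of_apply {g : W} (h0 : g [false] = [false]) (h1 : g [true] = [true]) :
    g = pair (restrict g false h0) (restrict g true h1) := by
  ext1 x
  match x with
  | [] => rw [apply_nil, apply_nil]
  | false :: x => rw [pair_apply_false, apply_cons_eq_cons_tail h0]; rfl
  | true :: x => rw [pair_apply_true, apply_cons_eq_cons_tail h1]; rfl

theorem exists_eq_pair (g : W) : ∃ u v, g = pair u v ∨ g = pair u v * σ := by
  have key : ∀ g : W, g [false] = [false] → ∃ u v, g = pair u v := by
    intro g h0
    have h1 : g [true] = [true] := by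
      obtain ⟨b, hb⟩ := List.length_eq_one_iff.1 (length_apply g [true])
      cases b with
      | false => exact absurd (g.injective (hb.trans h0.symm)) (by simp)
      | true => exact hb
    exact ⟨_, _, eq_pair_of_apply h0 h1⟩
  obtain ⟨b, hb⟩ := List.length_eq_one_iff.1 (length_apply g [false])
  cases b with
  | false =>
    obtain ⟨u, v, h⟩ := key g hb
    exact ⟨u, v, Or.inl h⟩
  | true =>
    obtain ⟨u, v, h⟩ := key (σ * g) (by rw [RelIso.mul_apply, hb]; rfl)
    refine ⟨v, u, Or.inr ?_⟩
    rw [← σ_mul_pair, ← h, ← mul_assoc, σ_mul_σ, one_mul]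

theorem isConj_pair {u v u' v' : W} (hu : IsConj u u') (hv : IsConj v v') :
    IsConj (pair u v) (pair u' v') := by
  obtain ⟨x, rfl⟩ := isConj_iff.1 hu
  obtain ⟨y, rfl⟩ := isConj_iff.1 hv
  exact isConj_iff.2 ⟨pair x y, by rw [pair_mul, pair_inv, pair_mul]⟩

theorem exists_eq_pair_of_isConj_pair {g u v : W} (h : IsConj g (pair u v)) :
    ∃ u' v', IsConj u' u ∧ IsConj v' v ∧ (g = pair u' v' ∨ g = pair v' u') := by
  obtain ⟨k, rfl⟩ := isConj_iff.1 h.symm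
  obtain ⟨x, y, rfl | rfl⟩ := exists_eq_pair k
  · exact ⟨x * u * x⁻¹, y * v * y⁻¹, (isConj_iff.2 ⟨x, rfl⟩).symm, (isConj_iff.2 ⟨y, rfl⟩).symm,
      Or.inl (by rw [pair_inv, pair_mul, pair_mul])⟩
  · refine ⟨y * u * y⁻¹, x * v * x⁻¹, (isConj_iff.2 ⟨y, rfl⟩).symm,
      (isConj_iff.2 ⟨x, rfl⟩).symm, Or.inr ?_⟩
    calc pair x y * σ * pair u v * (pair x y * σ)⁻¹
        = pair x y * (σ * pair u v * σ) * (pair x y)⁻¹ := by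
          rw [mul_inv_rev, σ_inv]; group
      _ = _ := by rw [σ_mul_pair_mul_σ, pair_inv, pair_mul, pair_mul]

theorem exists_eq_of_isConj_σ {g : W} (h : IsConj g σ) : ∃ c, g = pair c c⁻¹ * σ := by
  obtain ⟨k, rfl⟩ := isConj_iff.1 h.symm
  obtain ⟨x, y, rfl | rfl⟩ := exists_eq_pair k
  · refine ⟨x * y⁻¹, ?_⟩
    rw [pair_inv, mul_assoc, σ_mul_pair, ← mul_assoc, pair_mul, mul_inv_rev, inv_inv]
  · refine ⟨x * y⁻¹, ?_⟩
    rw [mul_inv_rev, σ_inv, pair_inv, mul_assoc (pair x y), σ_mul_σ, mul_one, σ_mul_pair,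
      ← mul_assoc, pair_mul, mul_inv_rev, inv_inv]

/-! ### Agreement up to a level -/

theorem Agree.symm {n : ℕ} {g h : W} (H : Agree n g h) : Agree n h g :=
  fun x hx => (H x hx).symm

theorem Agree.trans {n : ℕ} {g h k : W} (H : Agree n g h) (H' : Agree n h k) : Agree n g k :=
  fun x hx => (H x hx).trans (H' x hx)

theorem Agree.mono {m n : ℕ} (hmn : m ≤ n) {g h : W} (H : Agree n g h) : Agree m g h :=
  fun x hx => H x (hx.trans hmn)

theorem agree_conj {n : ℕ} {g h : W} (k : W) (H : Agree n g h) :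
    Agree n (k * g * k⁻¹) (k * h * k⁻¹) :=
  agree_mul (agree_mul (agree_refl n k) H) (agree_refl n k⁻¹)

theorem agree_of_pair {n : ℕ} {u v u' v' : W} (H : Agree (n + 1) (pair u v) (pair u' v')) :
    Agree n u u' ∧ Agree n v v' := by
  refine ⟨fun x hx => ?_, fun x hx => ?_⟩
  · have := H (false :: x) (by simpa using hx)
    simpa [pair_apply_false] using this
  · have := H (true :: x) (by simpa using hx)
    simpa [pair_apply_true] using this

theorem agree_list_prod {n : ℕ} {ι : Type*} {f g : ι → W} (L : List ι)
    (H : ∀ x ∈ L, Agree n (f x) (g x)) : Agree n (L.map f).prod (L.map g).prod := by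
  induction L with
  | nil => exact agree_refl _ _
  | cons x L ih =>
    simp only [List.map_cons, List.prod_cons]
    exact agree_mul (H x (by simp)) (ih fun y hy => H y (by simp [hy]))

theorem agree_mul_swap {n : ℕ} {g h : W} (H : Agree n (g * h) 1) : Agree n (h * g) 1 := by
  have := agree_conj h H
  rw [mul_one, mul_inv_cancel] at this
  convert this using 1
  group

theorem agree_inv_of_mul {n : ℕ} {g h : W} (H : Agree n (g * h) 1) : Agree n g h⁻¹ := by
  have := agree_mul H (agree_refl n h⁻¹)
  rwa [mul_assoc, mul_inv_cancel, mul_one, one_mul] at this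

theorem isOpen_agree (n : ℕ) (h : W) : IsOpen {g : W | Agree n g h} := by
  have : {g : W | Agree n g h} = ⋂ x ∈ {x : List Bool | x.length ≤ n}, {g : W | g x = h x} := by
    ext g
    simp [Agree]
  rw [this]
  exact (List.finite_length_le Bool n).isOpen_biInter fun x _ => isOpen_apply_eq x _

/-- Such a set is a union of classes of the level-$n$ congruence, so its complement is open. -/
theorem isClosed_of_agree {n : ℕ} {S : Set W} (H : ∀ g h, Agree n g h → h ∈ S → g ∈ S) :
    IsClosed S := by
  rw [← isOpen_compl_iff, isOpen_iff_mem_nhds]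
  intro g hg
  filter_upwards [(isOpen_agree n g).mem_nhds (agree_refl n g)] with h hh hS
  exact hg (H g h hh.symm hS)

theorem exists_agree_of_mem_closure {S : Set W} {g : W} (hg : g ∈ closure S) (n : ℕ) :
    ∃ h ∈ S, Agree n h g := by
  obtain ⟨h, h1, h2⟩ := mem_closure_iff.1 hg _ (isOpen_agree n g) (agree_refl n g)
  exact ⟨h, h2, h1⟩

theorem eq_of_agree {g h : W} (H : ∀ n, Agree n g h) : g = h :=
  RelIso.ext fun x => H x.length x le_rfl

theorem mem_nhds_iff_agree {g : W} {S : Set W} : S ∈ 𝓝 g ↔ ∃ n, {h | Agree n h g} ⊆ S := by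
  constructor
  · intro hS
    let _ : TopologicalSpace (List Bool) := ⊥
    have : DiscreteTopology (List Bool) := ⟨rfl⟩
    rw [nhds_induced, mem_comap] at hS
    obtain ⟨V, hV, hVS⟩ := hS
    rw [nhds_pi, Filter.mem_pi'] at hV
    obtain ⟨I, s, hs, hIV⟩ := hV
    refine ⟨I.sup List.length, fun h hh => hVS (hIV fun x hx => ?_)⟩
    have hx' : h x = g x := hh x (Finset.le_sup (f := List.length) hx)
    change h x ∈ s x
    rw [hx']
    exact mem_of_mem_nhds (hs x)
  · rintro ⟨n, hn⟩
    exact mem_of_superset ((isOpen_agree n g).mem_nhds (agree_refl n g)) hn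

theorem mem_of_forall_exists_agree {S : Set W} (hS : IsClosed S) {g : W}
    (H : ∀ n, ∃ h ∈ S, Agree n h g) : g ∈ S := by
  rw [← hS.closure_eq, mem_closure_iff_nhds]
  intro V hV
  obtain ⟨n, hn⟩ := mem_nhds_iff_agree.1 hV
  obtain ⟨h, h1, h2⟩ := H n
  exact ⟨h, hn h2, h1⟩

theorem continuous_pair_left (v : W) : Continuous fun u : W => pair u v := by
  refine continuous_iff_continuousAt.2 fun u S hS => ?_
  obtain ⟨n, hn⟩ := mem_nhds_iff_agree.1 hS
  exact mem_nhds_iff_agree.2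
    ⟨n, fun u' hu' => hn ((agree_pair hu' (agree_refl n v)).mono n.le_succ)⟩

/-- Levels are finite and preserved, so along an ultrafilter the image of each vertex is eventually
constant. Tracking inverses as well makes the pointwise limit bijective. -/
instance instCompactSpaceW : CompactSpace W where
  isCompact_univ := by
    rw [isCompact_iff_ultrafilter_le_nhds]
    intro U _
    have key : ∀ (F : W → W) (x : List Bool), ∃ y, ∀ᶠ g in (U : Filter W), F g x = y := by
      intro F x
      have h : (⋃ y ∈ {y : List Bool | y.length ≤ x.length}, {g : W | F g x = y}) ∈ U := by
        refine mem_of_superset Filter.univ_mem fun g _ => ?_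
        simp [length_apply]
      rw [Ultrafilter.finite_biUnion_mem_iff (List.finite_length_le Bool x.length)] at h
      obtain ⟨y, -, hy⟩ := h
      exact ⟨y, hy⟩
    choose f hf using key id
    choose f' hf' using key (·⁻¹)
    let k : W :=
      { toFun := f
        invFun := f'
        left_inv := fun x => by
          obtain ⟨g, h1, h2⟩ := ((hf x).and (hf' (f x))).exists
          rw [← h2, ← h1]
          exact RelIso.inv_apply_self g x
        right_inv := fun x => by
          obtain ⟨g, h1, h2⟩ := ((hf' x).and (hf (f' x))).exists
          rw [← h2, ← h1]
          exact RelIso.apply_inv_self g x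
        map_rel_iff' := fun {x y} => by
          obtain ⟨g, h1, h2⟩ := ((hf x).and (hf y)).exists
          change f x <+: f y ↔ x <+: y
          rw [← h1, ← h2]
          exact prefix_iff g x y }
    refine ⟨k, trivial, fun S hS => ?_⟩
    obtain ⟨n, hn⟩ := mem_nhds_iff_agree.1 hS
    refine mem_of_superset ?_ hn
    change ∀ᶠ g in (U : Filter W), ∀ x : List Bool, x ∈ {x : List Bool | x.length ≤ n} → g x = k x
    rw [Filter.eventually_all_finite (List.finite_length_le Bool n)]
    exact fun x _ => hf x

/-! ### Finite levels are two-groups -/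

/-- The square of any element fixes both vertices of level one, so each further level costs one
squaring. -/
theorem agree_pow_two_pow (n : ℕ) (g : W) : Agree n (g ^ 2 ^ n) 1 := by
  induction n generalizing g with
  | zero => exact agree_zero _ _
  | succ n ih =>
    have h : ∃ u v, g ^ 2 = pair u v := by
      obtain ⟨u, v, rfl | rfl⟩ := exists_eq_pair g
      · exact ⟨_, _, by rw [pow_two, pair_mul]⟩
      · exact ⟨_, _, by rw [pow_two, mul_assoc, ← mul_assoc σ, σ_mul_pair_mul_σ, pair_mul]⟩
    obtain ⟨u, v, h⟩ := h
    have hp : ∀ m : ℕ, pair u v ^ m = pair (u ^ m) (v ^ m) := by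
      intro m
      induction m with
      | zero => simp [pair_one]
      | succ m ihm => rw [pow_succ, ihm, pair_mul, pow_succ, pow_succ]
    rw [pow_succ', pow_mul, h, hp, ← pair_one]
    exact agree_pair (ih u) (ih v)

/-- The action of `W` on the tree truncated at level `n`. -/
def truncate (n : ℕ) : W →* Equiv.Perm {x : List Bool // x.length ≤ n} where
  toFun g :=
    { toFun := fun x => ⟨g x, by rw [length_apply]; exact x.2⟩
      invFun := fun x => ⟨g⁻¹ x, by rw [length_apply]; exact x.2⟩
      left_inv := fun x => Subtype.ext (RelIso.inv_apply_self g x.1)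
      right_inv := fun x => Subtype.ext (RelIso.apply_inv_self g x.1) }
  map_one' := rfl
  map_mul' _ _ := rfl

theorem truncate_eq_iff {n : ℕ} {g h : W} : truncate n g = truncate n h ↔ Agree n g h := by
  constructor
  · intro H x hx
    exact congrArg Subtype.val (DFunLike.congr_fun H ⟨x, hx⟩)
  · intro H
    ext1 x
    exact Subtype.ext (H x.1 x.2)

theorem isPGroup_range_truncate (n : ℕ) : IsPGroup 2 (truncate n).range := by
  rintro ⟨_, g, rfl⟩
  refine ⟨n, Subtype.ext ?_⟩
  change truncate n g ^ 2 ^ n = 1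
  rw [← map_pow, ← map_one (truncate n), truncate_eq_iff]
  exact agree_pow_two_pow n g

/-- In a finite `p`-group, generators may be replaced by conjugates. -/
theorem _root_.IsPGroup.closure_conj_eq_top {p : ℕ} [Fact p.Prime] {P ι : Type*} [Group P]
    [Finite P] (hP : IsPGroup p P) (s g : ι → P) (hs : Subgroup.closure (Set.range s) = ⊤) :
    Subgroup.closure (Set.range fun i => g i * s i * (g i)⁻¹) = ⊤ := by
  by_contra hne
  -- Maximal subgroups of a nilpotent group are normal, so a proper one containing the conjugates
  -- would contain the original generators.
  obtain ⟨M, hM, hle⟩ := (eq_top_or_exists_le_coatom _).resolve_left hne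
  have := hP.isNilpotent
  have hn : M.Normal := Subgroup.NormalizerCondition.normal_of_coatom M
    Group.normalizerCondition_of_isNilpotent hM
  apply hM.1
  rw [eq_top_iff, ← hs, Subgroup.closure_le]
  rintro _ ⟨i, rfl⟩
  have h := hle (Subgroup.subset_closure ⟨i, rfl⟩)
  simpa [mul_assoc] using hn.conj_mem _ h (g i)⁻¹

/-! ### The standard generators as a single family -/

variable {r : ℕ}

namespace GenIndex

/-- The first child of an index: the generator with index `x` is conjugate to the pair of the
generators indexed by its children, or to `σ` if it has none. -/
def left : GenIndex r → Option (GenIndex r)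
  | .a i _ => if h : 1 < i then some (.a (i - 1) (by omega)) else none
  | .b j _ hjr => if h : 1 < j then some (.b (j - 1) (by omega) (by omega)) else none

/-- The second child of an index. -/
def right (hr : 1 ≤ r) : GenIndex r → Option (GenIndex r)
  | .a i _ => if i = r + 1 then some (.b r hr le_rfl) else none
  | .b _ _ _ => none

/-- The index of which a given index is a child. -/
def parent : GenIndex r → GenIndex r
  | .a i _ => .a (i + 1) (by omega)
  | .b j hj hjr => if h : j < r then .b (j + 1) (by omega) (by omega) else .a (r + 1) (by omega)

/-- The position of an index within its family. -/
def rank : GenIndex r → ℕ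
  | .a i _ => i
  | .b j _ _ => j

/-- The index of `a_1`. -/
def α : GenIndex r := .a 1 le_rfl

/-- The index of `b_1`. -/
def β (hr : 1 ≤ r) : GenIndex r := .b 1 le_rfl hr

/-- The index of `b_r`. -/
def τ (hr : 1 ≤ r) : GenIndex r := .b r hr le_rfl

theorem left_eq_none_iff (hr : 1 ≤ r) (x : GenIndex r) : x.left = none ↔ x = α ∨ x = β hr := by
  cases x with
  | a i hi =>
    simp only [left, α, β, a.injEq, reduceCtorEq, or_false, dite_eq_right_iff, imp_false,
      not_lt]
    omega
  | b j hj hjr =>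
    simp only [left, α, β, b.injEq, reduceCtorEq, false_or, dite_eq_right_iff, imp_false,
      not_lt]
    omega

/-- Together with `right_eq_some_iff` this says that each index is a child exactly once: `τ` on the
right, all others on the left. -/
theorem left_eq_some_iff (hr : 1 ≤ r) (x y : GenIndex r) :
    x.left = some y ↔ y ≠ τ hr ∧ x = y.parent := by
  cases x <;> cases y <;> simp only [left, parent, τ] <;> split_ifs <;> simp <;> omega

theorem right_eq_some_iff (hr : 1 ≤ r) (x y : GenIndex r) :
    x.right hr = some y ↔ y = τ hr ∧ x = y.parent := by
  cases x <;> cases y <;> simp only [right, parent, τ]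
  · split_ifs <;> simp
  · split_ifs <;> simp <;> omega
  · simp
  · split_ifs
    · simp; omega
    · simp

theorem rank_parent (x : GenIndex r) : x.parent.rank ≤ x.rank + 1 := by
  cases x with
  | a i hi => exact le_rfl
  | b j hj hjr =>
    simp only [parent]
    split_ifs <;> simp only [rank] <;> omega

theorem parent_ne_α (x : GenIndex r) : x.parent ≠ α := by
  cases x with
  | a i hi => simp [parent, α]; omega
  | b j hj hjr =>
    simp only [parent, α]
    split_ifs
    · simp
    · simp; omega

theorem parent_ne_β (hr : 1 ≤ r) (x : GenIndex r) : x.parent ≠ β hr := by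
  cases x with
  | a i hi => simp [parent, β]
  | b j hj hjr =>
    simp only [parent, β]
    split_ifs
    · simp; omega
    · simp

theorem finite_rank_le (n : ℕ) : {x : GenIndex r | x.rank ≤ n}.Finite := by
  have h1 : (Set.range fun i : Fin n => (.a (i + 1) (by omega) : GenIndex r)).Finite :=
    Set.finite_range _
  have h2 : (Set.range fun j : Fin r => (.b (j + 1) (by omega) (by omega) : GenIndex r)).Finite :=
    Set.finite_range _
  refine (h1.union h2).subset fun x hx => ?_
  cases x with
  | a i hi =>
    exact Or.inl ⟨⟨i - 1, by simp only [Set.mem_ofPred_eq, rank] at hx; omega⟩,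
      by simp only [a.injEq]; omega⟩
  | b j hj hjr => exact Or.inr ⟨⟨j - 1, by omega⟩, by simp only [b.injEq]; omega⟩

end GenIndex

open GenIndex

/-- The member of a family at an optional index. -/
def value (c : GenIndex r → W) (o : Option (GenIndex r)) : W := o.elim 1 c

@[simp] theorem value_none (c : GenIndex r → W) : value c none = 1 := rfl

@[simp] theorem value_some (c : GenIndex r → W) (x : GenIndex r) : value c (some x) = c x := rfl

/-- The family of all standard generators. -/
noncomputable def std (hr : 1 ≤ r) : GenIndex r → W := genFamily r (stdA r hr) (stdB r hr)

theorem closedSubgroupGen_eq (a b : ℕ → W) : closedSubgroupGen r a b =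
    (Subgroup.closure (Set.range (genFamily r a b))).topologicalClosure := by
  have : {g | ∃ i, 1 ≤ i ∧ g = a i} ∪ {g | ∃ j, 1 ≤ j ∧ j ≤ r ∧ g = b j} =
      Set.range (genFamily r a b) := by
    ext g
    constructor
    · rintro (⟨i, hi, rfl⟩ | ⟨j, hj, hjr, rfl⟩)
      · exact ⟨.a i hi, rfl⟩
      · exact ⟨.b j hj hjr, rfl⟩
    · rintro ⟨i | j, rfl⟩
      · exact Or.inl ⟨_, by assumption, rfl⟩
      · exact Or.inr ⟨_, by assumption, by assumption, rfl⟩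
  rw [closedSubgroupGen, this]

theorem isClosed_G (hr : 1 ≤ r) : IsClosed (G r hr : Set W) :=
  Subgroup.isClosed_topologicalClosure _

theorem std_mem (hr : 1 ≤ r) (x : GenIndex r) : std hr x ∈ G r hr := by
  rw [G, closedSubgroupGen_eq]
  exact Subgroup.le_topologicalClosure _ (Subgroup.subset_closure ⟨x, rfl⟩)

/-- A closed subgroup that contains the standard generators contains `G(r)`. -/
theorem G_le_of_isClosed (hr : 1 ≤ r) (H : Subgroup W) (hH : IsClosed (H : Set W))
    (h : ∀ x, std hr x ∈ H) : G r hr ≤ H := by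
  rw [G, closedSubgroupGen_eq]
  refine Subgroup.topologicalClosure_minimal _ ?_ hH
  rw [Subgroup.closure_le]
  rintro _ ⟨x, rfl⟩
  exact h x

theorem std_α (hr : 1 ≤ r) : std hr α = σ := (isStandard_std r hr).a_one

theorem std_β (hr : 1 ≤ r) : std hr (β hr) = pair (std hr (τ hr)) (std hr (τ hr))⁻¹ * σ :=
  (isStandard_std r hr).b_one

theorem σ_mem (hr : 1 ≤ r) : σ ∈ G r hr := std_α hr ▸ std_mem hr α

theorem std_a_eq_pair (hr : 1 ≤ r) {i : ℕ} (hi : 1 < i) :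
    std hr (.a i hi.le) =
      pair (value (std hr) (GenIndex.a i hi.le : GenIndex r).left) (value (std hr) ((GenIndex.a i hi.le : GenIndex r).right hr)) := by
  simp only [GenIndex.left, hi, GenIndex.right, dite_true, value_some]
  split_ifs with h
  · subst h
    exact (isStandard_std r hr).a_special
  · exact (isStandard_std r hr).a_other i hi h

theorem std_b_eq_pair (hr : 1 ≤ r) {j : ℕ} (hj : 1 < j) (hjr : j ≤ r) :
    std hr (.b j hj.le hjr) = pair (std hr (τ hr) *
      value (std hr) (GenIndex.b j hj.le hjr).left * (std hr (τ hr))⁻¹) 1 := by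
  simp only [GenIndex.left, hj, dite_true, value_some]
  exact (isStandard_std r hr).b_other j hj hjr

/-- The element $b_1=(b_r,b_r^{-1})\sigma$ squares to one whatever $b_r$ is, and each later $b_j$ is
built from a conjugate of $b_{j-1}$. -/
theorem std_b_mul_self (hr : 1 ≤ r) {j : ℕ} (hj : 1 ≤ j) (hjr : j ≤ r) :
    std hr (.b j hj hjr) * std hr (.b j hj hjr) = 1 := by
  induction j, hj using Nat.le_induction with
  | base =>
    change std hr (β hr) * std hr (β hr) = 1
    rw [std_β, mul_assoc, ← mul_assoc σ, σ_mul_pair_mul_σ, pair_mul, mul_inv_cancel,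
      inv_mul_cancel, pair_one]
  | succ j hj ih =>
    have h := ih (by omega)
    have hl : (GenIndex.b (j + 1) (by omega) hjr).left = some (.b j hj (by omega)) := by
      simp [GenIndex.left, show 0 < j by omega]
    have ht : std hr (τ hr) * std hr (.b j hj (by omega)) * (std hr (τ hr))⁻¹ *
        (std hr (τ hr) * std hr (.b j hj (by omega)) * (std hr (τ hr))⁻¹) = 1 := by
      calc _ = std hr (τ hr) * (std hr (.b j hj (by omega)) * std hr (.b j hj (by omega))) *
            (std hr (τ hr))⁻¹ := by group
        _ = 1 := by rw [h, mul_one, mul_inv_cancel]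
    rw [std_b_eq_pair hr (by omega) hjr, hl, value_some, pair_mul, one_mul, ht, pair_one]

theorem std_τ_mul_self (hr : 1 ≤ r) : std hr (τ hr) * std hr (τ hr) = 1 :=
  std_b_mul_self hr hr le_rfl

theorem std_τ_inv (hr : 1 ≤ r) : (std hr (τ hr))⁻¹ = std hr (τ hr) :=
  inv_eq_of_mul_eq_one_left (std_τ_mul_self hr)

/-! ### Pairs in `G(r)` -/

theorem pair_swap_mem (hr : 1 ≤ r) {x y : W} (h : pair x y ∈ G r hr) : pair y x ∈ G r hr := by
  rw [← σ_mul_pair_mul_σ]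
  exact mul_mem (mul_mem (σ_mem hr) h) (σ_mem hr)

/-- This is $b_1\sigma$, because $b_r$ is an involution. -/
theorem pair_τ_τ_mem (hr : 1 ≤ r) : pair (std hr (τ hr)) (std hr (τ hr)) ∈ G r hr := by
  have h := mul_mem (std_mem hr (β hr)) (σ_mem hr)
  rwa [std_β, mul_assoc, σ_mul_σ, mul_one, std_τ_inv] at h

theorem conjUnder_std (hr : 1 ≤ r) (x : GenIndex r) (hx : x.left ≠ none) :
    ConjUnder (G r hr) (pair (value (std hr) x.left) (value (std hr) (x.right hr))) (std hr x) := by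
  cases x with
  | a i hi =>
    have hi1 : 1 < i := by
      by_contra h
      exact hx (by simp [GenIndex.left, h])
    exact ⟨1, one_mem _, by rw [std_a_eq_pair hr hi1]; group⟩
  | b j hj hjr =>
    have hj1 : 1 < j := by
      by_contra h
      exact hx (by simp [GenIndex.left, h])
    refine ⟨_, pair_τ_τ_mem hr, ?_⟩
    rw [std_b_eq_pair hr hj1 hjr, pair_inv, pair_mul, pair_mul]
    simp [GenIndex.right]

/-- The image of an index in the quotient of order at most two of `G(r)`, realized by the
subgroup generated by `b_r`. -/
noncomputable def parity (hr : 1 ≤ r) (x : GenIndex r) : W :=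
  value (std hr) (x.parent.right hr)

theorem value_right_eq (hr : 1 ≤ r) (x : GenIndex r) :
    value (std hr) (x.right hr) = 1 ∨ value (std hr) (x.right hr) = std hr (τ hr) := by
  rcases h : x.right hr with _ | y
  · exact Or.inl rfl
  · obtain ⟨rfl, -⟩ := (right_eq_some_iff hr _ _).1 h
    exact Or.inr rfl

theorem pair_std_parity_mem (hr : 1 ≤ r) (x : GenIndex r) :
    pair (std hr x) (parity hr x) ∈ G r hr := by
  by_cases hx : x = τ hr
  · rw [parity, (right_eq_some_iff hr _ _).2 ⟨hx, rfl⟩, hx]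
    exact pair_τ_τ_mem hr
  · have hl : x.parent.left = some x := (left_eq_some_iff hr _ _).2 ⟨hx, rfl⟩
    obtain ⟨g, hg, h⟩ := conjUnder_std hr x.parent (by simp [hl])
    have h1 := mul_mem (mul_mem (inv_mem hg) (std_mem hr x.parent)) hg
    rw [← h, hl, value_some] at h1
    convert h1 using 1
    rw [parity]
    group

theorem pair_one_mem_or (hr : 1 ≤ r) {x : W} (hx : x ∈ G r hr) :
    pair x 1 ∈ G r hr ∨ pair x (std hr (τ hr)) ∈ G r hr := by
  set t := std hr (τ hr) with ht
  have htt : t * t = 1 := std_τ_mul_self hr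
  -- Since $b_r^2=1$, these elements form a group; it is closed and contains the standard
  -- generators.
  let M : Subgroup W :=
    { carrier := {x | pair x 1 ∈ G r hr ∨ pair x t ∈ G r hr}
      one_mem' := Or.inl (by rw [pair_one]; exact one_mem _)
      mul_mem' := by
        rintro x y (hx | hx) (hy | hy) <;> have h := mul_mem hx hy <;> rw [pair_mul] at h
        · left; simpa using h
        · right; simpa using h
        · right; simpa using h
        · left; rwa [htt] at h
      inv_mem' := by
        rintro x (hx | hx) <;> have h := inv_mem hx <;> rw [pair_inv] at h
        · left; simpa using h
        · right; rwa [ht, std_τ_inv] at h }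
  have hM : IsClosed (M : Set W) :=
    ((isClosed_G hr).preimage (continuous_pair_left 1)).union
      ((isClosed_G hr).preimage (continuous_pair_left t))
  refine G_le_of_isClosed hr M hM (fun y => ?_) hx
  have h := pair_std_parity_mem hr y
  rw [parity] at h
  rcases value_right_eq hr y.parent with hy | hy <;> rw [hy] at h
  · exact Or.inl h
  · exact Or.inr h

theorem pair_mem_or (hr : 1 ≤ r) {x y : W} (hx : x ∈ G r hr) (hy : y ∈ G r hr) :
    pair x y ∈ G r hr ∨ pair x (std hr (τ hr) * y) ∈ G r hr := by
  have htt := std_τ_mul_self hr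
  rcases pair_one_mem_or hr hx with h1 | h1 <;> rcases pair_one_mem_or hr hy with h2 | h2 <;>
    replace h2 := pair_swap_mem hr h2
  · left
    simpa [pair_mul] using mul_mem h1 h2
  · right
    simpa [pair_mul, htt] using mul_mem h1 (mul_mem (pair_τ_τ_mem hr) h2)
  · right
    simpa [pair_mul] using mul_mem h1 h2
  · left
    simpa [pair_mul, htt, ← mul_assoc] using mul_mem h1 (mul_mem (pair_τ_τ_mem hr) h2)

/-- Conjugate $(x,\text{parity})$ by $(g,1)$ or $(g,b_r)$, whichever lies in $G(r)$; both leave the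
second entry alone, as it is $1$ or $b_r$. -/
theorem pair_conj_parity_mem (hr : 1 ≤ r) (x : GenIndex r) {g : W} (hg : g ∈ G r hr) :
    pair (g⁻¹ * std hr x * g) (parity hr x) ∈ G r hr := by
  have key : ∀ y, pair g y ∈ G r hr → y⁻¹ * parity hr x * y = parity hr x →
      pair (g⁻¹ * std hr x * g) (parity hr x) ∈ G r hr := by
    intro y hy h
    have := mul_mem (mul_mem (inv_mem hy) (pair_std_parity_mem hr x)) hy
    rwa [pair_inv, pair_mul, pair_mul, h] at this
  rcases pair_one_mem_or hr hg with h | h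
  · exact key _ h (by simp)
  · refine key _ h ?_
    rcases value_right_eq hr x.parent with h | h <;> simp [parity, h]

theorem pair_list_prod_mem (hr : 1 ≤ r) (g : GenIndex r → W) (hg : ∀ x, g x ∈ G r hr)
    (D : List (GenIndex r)) :
    pair (D.map fun x => (g x)⁻¹ * std hr x * g x).prod (D.map (parity hr)).prod ∈ G r hr := by
  induction D with
  | nil => simp [pair_one]
  | cons x D ih =>
    simpa [pair_mul] using mul_mem (pair_conj_parity_mem hr x (hg x)) ih

/-! ### Families satisfying the conjugacy relations -/

/-- The conjugacy relations between the members of a family. -/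
structure IsConjFamily (hr : 1 ≤ r) (c : GenIndex r → W) : Prop where
  of_none : ∀ x, x.left = none → IsConj (c x) σ
  of_some : ∀ x, x.left ≠ none → IsConj (c x) (pair (value c x.left) (value c (x.right hr)))

theorem isConj_value {c d : GenIndex r → W} (h : ∀ x, IsConj (d x) (c x))
    (o : Option (GenIndex r)) : IsConj (value d o) (value c o) := by
  cases o with
  | none => exact IsConj.refl _
  | some x => exact h x

theorem IsConjFamily.of_isConj {hr : 1 ≤ r} {c d : GenIndex r → W} (hc : IsConjFamily hr c)
    (h : ∀ x, IsConj (d x) (c x)) : IsConjFamily hr d where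
  of_none x hx := (h x).trans (hc.of_none x hx)
  of_some x hx := (h x).trans ((hc.of_some x hx).trans
    (isConj_pair (isConj_value h _).symm (isConj_value h _).symm))

/-- The pair with the given entries, in reversed order if `s` is true. -/
def orientedPair (s : Bool) (u v : W) : W := if s then pair v u else pair u v

/-- One family `d` serves all the pairs at once because no index is a child twice. The flag `s`
records which side the conjugacy puts the left child on. -/
theorem IsConjFamily.exists_orientedPair {hr : 1 ≤ r} {c : GenIndex r → W}
    (hc : IsConjFamily hr c) : ∃ (d : GenIndex r → W) (s : GenIndex r → Bool),
      (∀ x, IsConj (d x) (c x)) ∧ ∀ x, x.left ≠ none →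
        c x = orientedPair (s x) (value d x.left) (value d (x.right hr)) := by
  classical
  have key : ∀ x : GenIndex r, ∃ (u v : W) (s : Bool), x.left ≠ none →
      IsConj u (value c x.left) ∧ IsConj v (value c (x.right hr)) ∧ c x = orientedPair s u v := by
    intro x
    by_cases hx : x.left = none
    · exact ⟨1, 1, true, fun h => absurd hx h⟩
    · obtain ⟨u, v, hu, hv, h | h⟩ := exists_eq_pair_of_isConj_pair (hc.of_some x hx)
      · exact ⟨u, v, false, fun _ => ⟨hu, hv, h⟩⟩
      · exact ⟨u, v, true, fun _ => ⟨hu, hv, h⟩⟩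
  choose u v s h using key
  have hp : ∀ y : GenIndex r, y.parent.left ≠ none := by
    intro y hy
    rcases (left_eq_none_iff hr _).1 hy with h | h
    · exact parent_ne_α y h
    · exact parent_ne_β hr y h
  refine ⟨fun y => if y = τ hr then v y.parent else u y.parent, s, fun y => ?_, fun x hx => ?_⟩
  · obtain ⟨hu, hv, -⟩ := h y.parent (hp y)
    dsimp only
    split_ifs with hy
    · rwa [(right_eq_some_iff hr _ _).2 ⟨hy, rfl⟩] at hv
    · rwa [(left_eq_some_iff hr _ _).2 ⟨hy, rfl⟩] at hu
  · obtain ⟨hu, hv, hx'⟩ := h x hx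
    rw [hx']
    congr 1
    · obtain ⟨y, hy⟩ := Option.ne_none_iff_exists'.1 hx
      obtain ⟨h1, rfl⟩ := (left_eq_some_iff hr _ _).1 hy
      rw [hy, value_some, if_neg h1]
    · rcases hy : x.right hr with _ | y
      · rw [hy, value_none] at hv
        -- A missing right child has value one, and only one is conjugate to one.
        exact isConj_one_left.1 hv
      · obtain ⟨h1, rfl⟩ := (right_eq_some_iff hr _ _).1 hy
        rw [value_some, if_pos h1]

/-! ### Passing from a product to the product of its components -/

/-- The children of an index that contribute to the first component. -/
def fstChildren (hr : 1 ≤ r) (s : GenIndex r → Bool) (x : GenIndex r) : List (GenIndex r) :=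
  if s x then (x.right hr).toList else x.left.toList

/-- The children of an index that contribute to the second component. -/
def sndChildren (hr : 1 ≤ r) (s : GenIndex r → Bool) (x : GenIndex r) : List (GenIndex r) :=
  if s x then x.left.toList else (x.right hr).toList

theorem prod_map_toList (d : GenIndex r → W) (o : Option (GenIndex r)) :
    (o.toList.map d).prod = value d o := by
  cases o <;> simp

theorem prod_map_eq_pair (hr : 1 ≤ r) {c d : GenIndex r → W} {s : GenIndex r → Bool}
    (L : List (GenIndex r)) (h : ∀ x ∈ L,
      c x = orientedPair (s x) (value d x.left) (value d (x.right hr))) :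
    (L.map c).prod = pair ((L.flatMap (fstChildren hr s)).map d).prod
      ((L.flatMap (sndChildren hr s)).map d).prod := by
  induction L with
  | nil => simp [pair_one]
  | cons x L ih =>
    have hx : c x = pair ((fstChildren hr s x).map d).prod ((sndChildren hr s x).map d).prod := by
      rw [h x (by simp), orientedPair, fstChildren, sndChildren]
      split_ifs <;> simp only [prod_map_toList]
    simp only [List.map_cons, List.prod_cons, List.flatMap_cons, List.map_append,
      List.prod_append]
    rw [ih fun y hy => h y (by simp [hy]), hx, pair_mul]

open scoped Classical in
theorem count_fstChildren_add (hr : 1 ≤ r) (s : GenIndex r → Bool) (x y : GenIndex r) :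
    (fstChildren hr s x).count y + (sndChildren hr s x).count y =
      if x = y.parent then 1 else 0 := by
  have key : x.left.toList.count y + (x.right hr).toList.count y =
      if x = y.parent then 1 else 0 := by
    have h1 := left_eq_some_iff hr x y
    have h2 := right_eq_some_iff hr x y
    have ht : ∀ o : Option (GenIndex r), o.toList.count y = if o = some y then 1 else 0 := by
      intro o
      cases o <;> simp [List.count_singleton]
    rw [ht, ht]
    simp only [h1, h2]
    by_cases hy : y = τ hr <;> simp [hy]
  rw [fstChildren, sndChildren, ← key]
  split_ifs <;> omega

open scoped Classical in
theorem count_flatMap_children (hr : 1 ≤ r) (s : GenIndex r → Bool) (L : List (GenIndex r))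
    (y : GenIndex r) : (L.flatMap (fstChildren hr s)).count y +
      (L.flatMap (sndChildren hr s)).count y = L.count y.parent := by
  induction L with
  | nil => simp
  | cons x L ih =>
    simp only [List.flatMap_cons, List.count_append, List.count_cons, ← ih]
    have h := count_fstChildren_add hr s x y
    simp only [beq_iff_eq]
    omega

/-- The index of $a_{r+1}$ sends $a_r$ to one side and $b_r$ to the other, both of parity $b_r$; for
every other `x` both sides have trivial parity. Hence `s` does not matter. -/
theorem prod_map_parity_children (hr : 1 ≤ r) {x : GenIndex r} (hx : x.left ≠ none)
    (s : GenIndex r → Bool) :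
    ((fstChildren hr s x).map (parity hr)).prod = value (std hr) (x.right hr) ∧
      ((sndChildren hr s x).map (parity hr)).prod = value (std hr) (x.right hr) := by
  have hl : (x.left.toList.map (parity hr)).prod = value (std hr) (x.right hr) := by
    obtain ⟨y, hy⟩ := Option.ne_none_iff_exists'.1 hx
    obtain ⟨-, rfl⟩ := (left_eq_some_iff hr _ _).1 hy
    simp [hy, parity]
  have hr' : ((x.right hr).toList.map (parity hr)).prod = value (std hr) (x.right hr) := by
    rcases hy : x.right hr with _ | y
    · rfl
    · obtain ⟨-, rfl⟩ := (right_eq_some_iff hr _ _).1 hy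
      simp [parity, hy]
  rw [fstChildren, sndChildren]
  split_ifs
  exacts [⟨hr', hl⟩, ⟨hl, hr'⟩]

theorem prod_map_parity_flatMap (hr : 1 ≤ r) (s : GenIndex r → Bool) (L : List (GenIndex r))
    (hL : ∀ x ∈ L, x.left ≠ none) :
    ((L.flatMap (fstChildren hr s)).map (parity hr)).prod =
        (L.map fun x => value (std hr) (x.right hr)).prod ∧
      ((L.flatMap (sndChildren hr s)).map (parity hr)).prod =
        (L.map fun x => value (std hr) (x.right hr)).prod := by
  induction L with
  | nil => simp
  | cons x L ih =>
    obtain ⟨h1, h2⟩ := ih fun y hy => hL y (by simp [hy])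
    obtain ⟨h3, h4⟩ := prod_map_parity_children hr (hL x (by simp)) s
    simp [h1, h2, h3, h4]

open scoped Classical in
theorem prod_map_value_right (hr : 1 ≤ r) (L : List (GenIndex r)) :
    (L.map fun x => value (std hr) (x.right hr)).prod = std hr (τ hr) ^ L.count (τ hr).parent := by
  induction L with
  | nil => simp
  | cons x L ih =>
    rw [List.map_cons, List.prod_cons, ih, List.count_cons]
    by_cases h : x = (τ hr).parent
    · rw [(right_eq_some_iff hr x _).2 ⟨rfl, h⟩]
      simp [h, pow_succ']
    · have : x.right hr = none := by
        rw [Option.eq_none_iff_forall_ne_some]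
        intro y hy
        obtain ⟨rfl, h'⟩ := (right_eq_some_iff hr x y).1 hy
        exact h h'
      simp [h, this]

/-! ### Conjugation to the standard generators up to a level -/

/-- Up to level `n`, the members of the family `c` become conjugate under `G(r)` to the standard
generators when they are conjugated by `w⁻¹`. -/
def IsLevelConjugator (hr : 1 ≤ r) (n : ℕ) (c : GenIndex r → W) (w : W) : Prop :=
  ∀ x, ∃ g ∈ G r hr, Agree n (g * (w⁻¹ * c x * w) * g⁻¹) (std hr x)

open scoped Classical in
-- Triviality of a product survives cyclic rotation, so the word may start at `α`. The single
-- occurrences of `α` and `β` are thereby split off, and the remaining indices all have children.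
theorem exists_rotation (hr : 1 ≤ r) {n : ℕ} {c : GenIndex r → W} {L : List (GenIndex r)}
    (h1 : L.count α = 1) (h2 : L.count (β hr) = 1) (hprod : Agree n (L.map c).prod 1) :
    ∃ P Q : List (GenIndex r), (∀ x ∈ P ++ Q, x.left ≠ none) ∧
      (∀ x, x ≠ α → x ≠ β hr → (P ++ Q).count x = L.count x) ∧
      Agree n (c α * (P.map c).prod * c (β hr) * (Q.map c).prod) 1 := by
  have hαβ : (α : GenIndex r) ≠ β hr := by simp [α, β]
  obtain ⟨S, T, rfl⟩ := List.append_of_mem (List.count_pos_iff.1 (h1 ▸ Nat.one_pos))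
  have h3 : β hr ∈ T ++ S := by
    have : β hr ∈ S ++ α :: T := List.count_pos_iff.1 (h2 ▸ Nat.one_pos)
    simp only [List.mem_append, List.mem_cons, hαβ.symm, false_or] at this ⊢
    exact this.symm
  obtain ⟨P, Q, hPQ⟩ := List.append_of_mem h3
  have hc : ∀ x, (S ++ α :: T).count x = (α :: (P ++ β hr :: Q)).count x := by
    intro x
    rw [← hPQ]
    simp only [List.count_append, List.count_cons]
    omega
  refine ⟨P, Q, fun x hx hn => ?_, fun x hx1 hx2 => ?_, ?_⟩
  · have hx' : 0 < (P ++ Q).count x := List.count_pos_iff.2 hx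
    rw [hc] at h1 h2
    simp only [List.count_append, List.count_cons] at h1 h2 hx'
    rcases (left_eq_none_iff hr x).1 hn with rfl | rfl
    · simp at h1; omega
    · simp at h2; omega
  · rw [hc]
    simp [List.count_append, hx1.symm, hx2.symm]
  · rw [List.map_append, List.prod_append] at hprod
    have h := agree_mul_swap hprod
    rw [List.map_cons, List.prod_cons, mul_assoc, ← List.prod_append, ← List.map_append,
      hPQ] at h
    simpa [mul_assoc] using h

/-- The product equals $(P_1e^{-1}Q_0,\,P_0eQ_1)$; rotating each trivial component isolates $e$. -/
theorem agree_components {n : ℕ} {P₀ P₁ Q₀ Q₁ e : W}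
    (h : Agree (n + 1) (σ * pair P₀ P₁ * (pair e e⁻¹ * σ) * pair Q₀ Q₁) 1) :
    Agree n (Q₀ * P₁) e ∧ Agree n (Q₁ * P₀) e⁻¹ := by
  have h' : σ * pair P₀ P₁ * (pair e e⁻¹ * σ) * pair Q₀ Q₁ =
      pair (P₁ * e⁻¹ * Q₀) (P₀ * e * Q₁) := by
    calc _ = σ * pair P₀ P₁ * pair e e⁻¹ * (σ * pair Q₀ Q₁) := by group
      _ = pair P₁ P₀ * (σ * pair e e⁻¹ * pair Q₁ Q₀ * σ) := by
          rw [σ_mul_pair, σ_mul_pair]; group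
      _ = _ := by rw [mul_assoc σ, pair_mul, σ_mul_pair_mul_σ, pair_mul]; simp only [mul_assoc]
  rw [h', ← pair_one] at h
  obtain ⟨h1, h2⟩ := agree_of_pair h
  replace h1 := agree_mul_swap h1
  replace h2 := agree_mul_swap h2
  rw [← mul_assoc] at h1 h2
  exact ⟨by simpa using agree_inv_of_mul h1, agree_inv_of_mul h2⟩

theorem conj_orientedPair (w : W) (s : Bool) (u v : W) :
    (pair w w)⁻¹ * orientedPair s u v * pair w w =
      orientedPair s (w⁻¹ * u * w) (w⁻¹ * v * w) := by
  rw [orientedPair, orientedPair]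
  split_ifs <;> rw [pair_inv, pair_mul, pair_mul]

/-- The two entries are conjugated separately by $g,h\in G(r)$, then $h$ is corrected so that the
pair of conjugators lies in $G(r)$. -/
theorem exists_agree_std_of_left_ne_none (hr : 1 ≤ r) {n : ℕ} {d : GenIndex r → W} {w : W}
    (hw : IsLevelConjugator hr n d w) {x : GenIndex r} (hx : x.left ≠ none) (s : Bool) :
    ∃ g ∈ G r hr, Agree (n + 1)
      (g * ((pair w w)⁻¹ * orientedPair s (value d x.left) (value d (x.right hr)) * pair w w) *
        g⁻¹) (std hr x) := by
  have hv : ∀ o : Option (GenIndex r), ∃ g ∈ G r hr,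
      Agree n (g * (w⁻¹ * value d o * w) * g⁻¹) (value (std hr) o) := by
    intro o
    cases o with
    | none => exact ⟨1, one_mem _, by simpa using agree_refl n 1⟩
    | some y => exact hw y
  obtain ⟨g, hg, hgl⟩ := hv x.left
  obtain ⟨h, hh, hhr⟩ := hv (x.right hr)
  obtain ⟨k, hk, hkx⟩ := conjUnder_std hr x hx
  rw [conj_orientedPair]
  set u := w⁻¹ * value d x.left * w
  set v := w⁻¹ * value d (x.right hr) * w
  have key : ∃ h', pair g h' ∈ G r hr ∧ Agree n (h' * v * h'⁻¹) (value (std hr) (x.right hr)) := by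
    rcases pair_mem_or hr hg hh with h1 | h1
    · exact ⟨h, h1, hhr⟩
    -- The corrected conjugator $b_rh$ still works, since $b_r$ commutes with the target entry $1$
    -- or $b_r$.
    · refine ⟨_, h1, ?_⟩
      have h2 := agree_conj (std hr (τ hr)) hhr
      have h3 : std hr (τ hr) * value (std hr) (x.right hr) * (std hr (τ hr))⁻¹ =
          value (std hr) (x.right hr) := by
        rcases value_right_eq hr x with h | h <;> simp [h]
      rw [h3] at h2
      convert h2 using 1
      group
  obtain ⟨h', hm, ha⟩ := key
  have hp : Agree (n + 1) (pair g h' * pair u v * (pair g h')⁻¹)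
      (pair (value (std hr) x.left) (value (std hr) (x.right hr))) := by
    rw [pair_inv, pair_mul, pair_mul]
    exact agree_pair hgl ha
  have hs : ∃ m ∈ G r hr, m * orientedPair s u v * m⁻¹ = pair u v := by
    rw [orientedPair]
    split_ifs
    · exact ⟨σ, σ_mem hr, by rw [σ_inv, σ_mul_pair_mul_σ]⟩
    · exact ⟨1, one_mem _, by group⟩
  obtain ⟨m, hm', hmu⟩ := hs
  refine ⟨k * pair g h' * m, mul_mem (mul_mem hk hm) hm', ?_⟩
  rw [← hmu] at hp
  have := agree_conj k hp
  rw [hkx] at this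
  convert this using 1
  group

/-- With $t=b_r$, conjugating $(e,e^{-1})\sigma$ by $(et,1)^{-1}$ gives $(t^{-1},t)\sigma$, which is
$b_1$ since $t^2=1$. -/
theorem exists_agree_std_β (hr : 1 ≤ r) {n : ℕ} {e e' : W} (he : Agree n e' e)
    (hm : pair e (std hr (τ hr)) ∈ G r hr) :
    ∃ g ∈ G r hr, Agree (n + 1) (g * (pair e' e'⁻¹ * σ) * g⁻¹) (std hr (β hr)) := by
  have hm' : pair (e * std hr (τ hr)) 1 ∈ G r hr := by
    simpa [pair_mul, std_τ_mul_self] using mul_mem hm (pair_τ_τ_mem hr)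
  refine ⟨_, inv_mem hm', ?_⟩
  have h := agree_conj (pair (e * std hr (τ hr)) 1)⁻¹
    (agree_mul (agree_pair he (agree_inv he)) (agree_refl (n + 1) σ))
  convert h using 1
  rw [inv_inv, mul_assoc, mul_assoc, σ_mul_pair, pair_inv, std_β, ← mul_assoc, ← mul_assoc,
    pair_mul, pair_mul, mul_inv_rev, std_τ_inv]
  simp [mul_assoc]

open scoped Classical in
theorem exists_isLevelConjugator_succ (hr : 1 ≤ r) {n : ℕ} {c : GenIndex r → W}
    (hc : IsConjFamily hr c) (hα : c α = σ) {L : List (GenIndex r)}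
    (hL : ∀ x : GenIndex r, x.rank ≤ n + 1 + r + 1 → L.count x = 1)
    (hprod : Agree (n + 1) (L.map c).prod 1)
    (ih : ∀ (d : GenIndex r → W), IsConjFamily hr d → ∀ D : List (GenIndex r),
      (∀ x : GenIndex r, x.rank ≤ n + r + 1 → D.count x = 1) → Agree n (D.map d).prod 1 →
        ∃ w, IsLevelConjugator hr n d w) :
    ∃ w, IsLevelConjugator hr (n + 1) c w := by
  obtain ⟨d, s, hd, hcd⟩ := hc.exists_orientedPair
  obtain ⟨e, he⟩ := exists_eq_of_isConj_σ
    (hc.of_none (β hr) ((left_eq_none_iff hr _).2 (Or.inr rfl)))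
  obtain ⟨P, Q, hPQ, hcount, hrot⟩ := exists_rotation hr
    (hL α (by simp only [α, rank]; omega)) (hL (β hr) (by simp only [β, rank]; omega)) hprod
  have hP : ∀ x ∈ P, x.left ≠ none := fun x hx => hPQ x (by simp [hx])
  have hQ : ∀ x ∈ Q, x.left ≠ none := fun x hx => hPQ x (by simp [hx])
  rw [hα, he, prod_map_eq_pair hr P fun x hx => hcd x (hP x hx),
    prod_map_eq_pair hr Q fun x hx => hcd x (hQ x hx)] at hrot
  obtain ⟨h1, h2⟩ := agree_components hrot
  rw [← List.prod_append, ← List.map_append] at h1 h2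
  -- `D₀` lists the factors of $Q_0P_1$ and `D₁` those of $Q_1P_0$, so their products agree with $e$
  -- and $e^{-1}$.
  set D₀ := Q.flatMap (fstChildren hr s) ++ P.flatMap (sndChildren hr s) with hD₀
  set D₁ := Q.flatMap (sndChildren hr s) ++ P.flatMap (fstChildren hr s) with hD₁
  obtain ⟨w, hw⟩ := ih d (hc.of_isConj hd) (D₀ ++ D₁)
    (fun x hx => by
      have hcx := hcount x.parent (parent_ne_α x) (parent_ne_β hr x)
      rw [hL x.parent (by have := rank_parent x; omega)] at hcx
      have h3 := count_flatMap_children hr s P x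
      have h4 := count_flatMap_children hr s Q x
      simp only [hD₀, hD₁, List.count_append] at hcx ⊢
      omega)
    (by
      rw [List.map_append, List.prod_append]
      simpa using agree_mul h1 h2)
  choose g hg hga using hw
  refine ⟨pair w w, fun x => ?_⟩
  by_cases hx : x.left = none
  · rcases (left_eq_none_iff hr x).1 hx with rfl | rfl
    · refine ⟨1, one_mem _, ?_⟩
      rw [hα, std_α, mul_assoc _ σ, σ_mul_pair]
      simpa using agree_refl _ _
    · have hconj : (pair w w)⁻¹ * c (β hr) * pair w w =
          pair (w⁻¹ * e * w) (w⁻¹ * e * w)⁻¹ * σ := by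
        rw [he, mul_assoc, mul_assoc, σ_mul_pair, pair_inv, ← mul_assoc, ← mul_assoc, pair_mul,
          pair_mul]
        simp only [mul_inv_rev, inv_inv, mul_assoc]
      rw [hconj]
      have hmem := pair_list_prod_mem hr g hg D₀
      -- The index of $a_{r+1}$ occurs once in `P ++ Q`, so it contributes exactly one child of
      -- parity $b_r$ to `D₀`.
      have hpar : (D₀.map (parity hr)).prod = std hr (τ hr) := by
        rw [hD₀, List.map_append, List.prod_append, (prod_map_parity_flatMap hr s Q hQ).1,
          (prod_map_parity_flatMap hr s P hP).2, prod_map_value_right, prod_map_value_right,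
          ← pow_add]
        have hcx := hcount (τ hr).parent (parent_ne_α _) (parent_ne_β hr _)
        rw [hL _ (by have := rank_parent (τ hr); simp only [τ, rank] at this ⊢; omega),
          List.count_append, add_comm] at hcx
        rw [hcx, pow_one]
      rw [hpar] at hmem
      refine exists_agree_std_β hr ?_ hmem
      have hw' : ∀ D : List (GenIndex r),
          w⁻¹ * (D.map d).prod * w = (D.map fun y => w⁻¹ * d y * w).prod := by
        intro D
        induction D with
        | nil => simp
        | cons y D ihD =>
          rw [List.map_cons, List.map_cons, List.prod_cons, List.prod_cons, ← ihD]
          group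
      -- Up to level $n$, $w^{-1}ew$ becomes a product of $G(r)$-conjugates of standard generators,
      -- the element for which membership was just shown.
      have h3 := agree_conj w⁻¹ h1.symm
      rw [inv_inv, hw'] at h3
      refine h3.trans (agree_list_prod D₀ fun y _ => ?_)
      have h4 := agree_conj (g y)⁻¹ (hga y)
      rw [inv_inv] at h4
      convert h4 using 1
      group
  · rw [hcd x hx]
    exact exists_agree_std_of_left_ne_none hr (fun y => ⟨g y, hg y, hga y⟩) hx (s x)

open scoped Classical in
-- A finite list with prescribed multiplicities only at small rank replaces the ordered product,
-- since this form passes to children. Each level uses up one unit of rank (`rank_parent`), and the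
-- summand `r` keeps $a_{r+1}$ within range.
theorem exists_isLevelConjugator (hr : 1 ≤ r) (n : ℕ) (c : GenIndex r → W)
    (hc : IsConjFamily hr c) (L : List (GenIndex r))
    (hL : ∀ x : GenIndex r, x.rank ≤ n + r + 1 → L.count x = 1)
    (hprod : Agree n (L.map c).prod 1) : ∃ w, IsLevelConjugator hr n c w := by
  induction n generalizing c L with
  | zero => exact ⟨1, fun x => ⟨1, one_mem _, agree_zero _ _⟩⟩
  | succ n ih =>
    -- Conjugating the whole family turns the member at `α` into $\sigma$ itself, which diagonal
    -- elements fix.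
    obtain ⟨u, hu⟩ := isConj_iff.1 (hc.of_none α ((left_eq_none_iff hr _).2 (Or.inl rfl)))
    obtain ⟨w, hw⟩ := exists_isLevelConjugator_succ hr (c := fun x => u * c x * u⁻¹)
      (hc.of_isConj fun x => (isConj_iff.2 ⟨u, rfl⟩).symm) hu hL
      (by
        have h1 : (L.map fun x => u * c x * u⁻¹).prod = u * (L.map c).prod * u⁻¹ := by
          clear hL hprod
          induction L with
          | nil => simp
          | cons y L ihL =>
            rw [List.map_cons, List.map_cons, List.prod_cons, List.prod_cons, ihL]
            group
        rw [h1]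
        simpa using agree_conj u hprod)
      ih
    refine ⟨u⁻¹ * w, fun x => ?_⟩
    obtain ⟨g, hg, h⟩ := hw x
    refine ⟨g, hg, ?_⟩
    convert h using 1
    group

/-! ### Conjugation to the standard generators -/

open scoped Classical in
theorem exists_list_of_hasOrderedProd {c : GenIndex r → W}
    (h : ∃ ord : LinearOrder (GenIndex r), HasOrderedProd ord c 1) (n m : ℕ) : ∃ L : List (GenIndex r),
      (∀ x : GenIndex r, x.rank ≤ m → L.count x = 1) ∧ Agree n (L.map c).prod 1 := by
  suffices h : ∃ L : List (GenIndex r), L.Nodup ∧ (∀ x : GenIndex r, x.rank ≤ m → x ∈ L) ∧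
      Agree n (L.map c).prod 1 by
    obtain ⟨L, hL, hm, hp⟩ := h
    exact ⟨L, fun x hx => List.count_eq_one_of_mem hL (hm x hx), hp⟩
  obtain ⟨ord, h⟩ := h
  have h1 : ∀ᶠ F : Finset (GenIndex r) in atTop,
      Agree n ((F.sort (fun x y => x ≤ y)).map c).prod 1 :=
    h ((isOpen_agree n 1).mem_nhds (agree_refl n 1))
  obtain ⟨F, hF, hF'⟩ := (h1.and (eventually_ge_atTop (finite_rank_le m).toFinset)).exists
  exact ⟨F.sort (fun x y => x ≤ y), F.sort_nodup _,
    fun x hx => (F.mem_sort _).2 (hF' ((finite_rank_le m).mem_toFinset.2 hx)), hF⟩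

theorem IsLevelConjugator.mono {hr : 1 ≤ r} {m n : ℕ} (hmn : m ≤ n) {c : GenIndex r → W} {w : W}
    (h : IsLevelConjugator hr n c w) : IsLevelConjugator hr m c w := by
  intro x
  obtain ⟨g, hg, hx⟩ := h x
  exact ⟨g, hg, hx.mono hmn⟩

theorem isClosed_isLevelConjugator (hr : 1 ≤ r) (n : ℕ) (c : GenIndex r → W) :
    IsClosed {w | IsLevelConjugator hr n c w} := by
  refine isClosed_of_agree (n := n) fun v w hvw hw x => ?_
  obtain ⟨g, hg, hx⟩ := hw x
  refine ⟨g, hg, Agree.trans (agree_conj g ?_) hx⟩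
  exact agree_mul (agree_mul (agree_inv hvw) (agree_refl n _)) hvw

/-- The conjugators for level $n$ form a decreasing sequence of nonempty closed subsets of the
compact group $W$. -/
theorem exists_forall_isLevelConjugator (hr : 1 ≤ r) {c : GenIndex r → W}
    (h : ∀ n, ∃ w, IsLevelConjugator hr n c w) : ∃ w, ∀ n, IsLevelConjugator hr n c w := by
  obtain ⟨w, hw⟩ := IsCompact.nonempty_iInter_of_sequence_nonempty_isCompact_isClosed
    (fun n => {w | IsLevelConjugator hr n c w}) (fun n w hw => hw.mono n.le_succ) h
    (isClosed_isLevelConjugator hr 0 c).isCompact (fun n => isClosed_isLevelConjugator hr n c)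
  exact ⟨w, Set.mem_iInter.1 hw⟩

/-- The conjugating element may vary with the level; compactness of the closed subgroup yields a
single one. -/
theorem conjUnder_of_forall_agree {H : Subgroup W} (hH : IsClosed (H : Set W)) {u v : W}
    (h : ∀ n, ∃ g ∈ H, Agree n (g * u * g⁻¹) v) : ConjUnder H u v := by
  have hcl : ∀ n, IsClosed ((H : Set W) ∩ {g | Agree n (g * u * g⁻¹) v}) := fun n =>
    hH.inter (isClosed_of_agree (n := n) fun g k hgk hk => Agree.trans
      (agree_mul (agree_mul hgk (agree_refl n u)) (agree_inv hgk)) hk)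
  obtain ⟨g, hg⟩ := IsCompact.nonempty_iInter_of_sequence_nonempty_isCompact_isClosed
    (fun n => (H : Set W) ∩ {g | Agree n (g * u * g⁻¹) v})
    (fun n g hg => ⟨hg.1, hg.2.mono n.le_succ⟩) h (hcl 0).isCompact hcl
  rw [Set.mem_iInter] at hg
  exact ⟨g, (hg 0).1, eq_of_agree fun n => (hg n).2⟩

/-- A family of elements that satisfies the conjugacy relations and has ordered product one is
simultaneously conjugate to the standard family, up to conjugation of each member by `G(r)`. -/
theorem exists_conjUnder_std (hr : 1 ≤ r) {c : GenIndex r → W} (hc : IsConjFamily hr c)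
    (h : ∃ ord : LinearOrder (GenIndex r), HasOrderedProd ord c 1) :
    ∃ w : W, ∀ x, ConjUnder (G r hr) (w⁻¹ * c x * w) (std hr x) := by
  obtain ⟨w, hw⟩ := exists_forall_isLevelConjugator hr (c := c) fun n => by
    obtain ⟨L, hL, hprod⟩ := exists_list_of_hasOrderedProd h n (n + r + 1)
    exact exists_isLevelConjugator hr n c hc L hL hprod
  exact ⟨w, fun x => conjUnder_of_forall_agree (isClosed_G hr) fun n => hw n x⟩

/-! ### The group generated by conjugates -/

theorem _root_.Subgroup.closure_range_subtype {Γ ι : Type*} [Group Γ] (P : Subgroup Γ)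
    (s : ι → P) : (Subgroup.closure (Set.range s)).map P.subtype =
      Subgroup.closure (Set.range fun i => (s i : Γ)) := by
  rw [MonoidHom.map_closure, ← Set.range_comp]
  rfl

/-- In a finite `p`-subgroup, generators may be replaced by conjugates. -/
theorem _root_.IsPGroup.closure_conj_eq {p : ℕ} [Fact p.Prime] {Γ ι : Type*} [Group Γ] [Finite Γ]
    (s g : ι → Γ) (hP : IsPGroup p (Subgroup.closure (Set.range s)))
    (hg : ∀ i, g i ∈ Subgroup.closure (Set.range s)) :
    Subgroup.closure (Set.range fun i => g i * s i * (g i)⁻¹) =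
      Subgroup.closure (Set.range s) := by
  set P := Subgroup.closure (Set.range s) with hPdef
  let s' : ι → P := fun i => ⟨s i, Subgroup.subset_closure ⟨i, rfl⟩⟩
  let g' : ι → P := fun i => ⟨g i, hg i⟩
  have hs' : Subgroup.closure (Set.range s') = ⊤ := by
    apply Subgroup.map_injective P.subtype_injective
    rw [Subgroup.closure_range_subtype, ← MonoidHom.range_eq_map, Subgroup.range_subtype]
  have h := congrArg (Subgroup.map P.subtype) (hP.closure_conj_eq_top s' g' hs')
  rw [Subgroup.closure_range_subtype, ← MonoidHom.range_eq_map, Subgroup.range_subtype] at h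
  exact h

theorem map_truncate_topologicalClosure (n : ℕ) (H : Subgroup W) :
    H.topologicalClosure.map (truncate n) = H.map (truncate n) := by
  refine le_antisymm ?_ (Subgroup.map_mono H.le_topologicalClosure)
  rintro _ ⟨g, hg, rfl⟩
  obtain ⟨h, hh, hhg⟩ := exists_agree_of_mem_closure hg n
  exact ⟨h, hh, truncate_eq_iff.2 hhg⟩

theorem topologicalClosure_le_of_map_truncate_le {H K : Subgroup W}
    (h : ∀ n, H.map (truncate n) ≤ K.map (truncate n)) :
    H.topologicalClosure ≤ K.topologicalClosure := by
  refine Subgroup.topologicalClosure_minimal _ (fun g hg => ?_)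
    (Subgroup.isClosed_topologicalClosure K)
  refine mem_of_forall_exists_agree (Subgroup.isClosed_topologicalClosure K) fun n => ?_
  obtain ⟨k, hk, hkg⟩ := h n ⟨g, hg, rfl⟩
  exact ⟨k, K.le_topologicalClosure hk, truncate_eq_iff.1 hkg⟩

theorem topologicalClosure_eq_of_map_truncate_eq {H K : Subgroup W}
    (h : ∀ n, H.map (truncate n) = K.map (truncate n)) :
    H.topologicalClosure = K.topologicalClosure :=
  le_antisymm (topologicalClosure_le_of_map_truncate_le fun n => (h n).le)
    (topologicalClosure_le_of_map_truncate_le fun n => (h n).ge)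

/-- A closed subgroup is determined by its images at finite levels, and a subgroup and its closure
have the same images. This lets the conjugators come from the closure while the finite 2-group
argument applies. -/
theorem topologicalClosure_closure_conj {ι : Type*} (s g : ι → W)
    (hg : ∀ i, g i ∈ (Subgroup.closure (Set.range s)).topologicalClosure) :
    (Subgroup.closure (Set.range fun i => g i * s i * (g i)⁻¹)).topologicalClosure =
      (Subgroup.closure (Set.range s)).topologicalClosure := by
  refine topologicalClosure_eq_of_map_truncate_eq fun n => ?_
  have : Finite {x : List Bool // x.length ≤ n} := List.finite_length_le Bool n
  have hs : (Subgroup.closure (Set.range s)).map (truncate n) =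
      Subgroup.closure (Set.range fun i => truncate n (s i)) := by
    rw [MonoidHom.map_closure, ← Set.range_comp]
    rfl
  have hle : Subgroup.closure (Set.range fun i => truncate n (s i)) ≤ (truncate n).range := by
    rw [← hs]
    exact Subgroup.map_le_range _ _
  have h := IsPGroup.closure_conj_eq (p := 2) (fun i => truncate n (s i))
    (fun i => truncate n (g i)) ((isPGroup_range_truncate n).to_le hle) (fun i => by
      rw [← hs, ← map_truncate_topologicalClosure]
      exact ⟨g i, hg i, rfl⟩)
  rw [hs, ← h, MonoidHom.map_closure, ← Set.range_comp]
  congr 2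

theorem topologicalClosure_map_conj (w : W) (H : Subgroup W) :
    (H.map (MulAut.conj w).toMonoidHom).topologicalClosure =
      H.topologicalClosure.map (MulAut.conj w).toMonoidHom := by
  refine SetLike.coe_injective ?_
  exact ((Homeomorph.mulLeft w).trans (Homeomorph.mulRight w⁻¹)).image_closure (H : Set W) |>.symm

theorem closedSubgroupGen_eq_map_conj (hr : 1 ≤ r) {a b : ℕ → W} {w : W}
    (h : ∀ x, ConjUnder (G r hr) (w⁻¹ * genFamily r a b x * w) (std hr x)) :
    closedSubgroupGen r a b = (G r hr).map (MulAut.conj w).toMonoidHom := by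
  choose g hg hx using h
  have hG : G r hr = (Subgroup.closure (Set.range (std hr))).topologicalClosure := by
    rw [G, closedSubgroupGen_eq]
    rfl
  have hg' : ∀ x, (g x)⁻¹ ∈ (Subgroup.closure (Set.range (std hr))).topologicalClosure :=
    fun x => hG ▸ inv_mem (hg x)
  rw [hG, ← topologicalClosure_closure_conj _ _ hg', ← topologicalClosure_map_conj,
    MonoidHom.map_closure, ← Set.range_comp, closedSubgroupGen_eq]
  congr 3
  ext1 x
  simp only [Function.comp_apply, ← hx x, MulEquiv.coe_toMonoidHom, MulAut.conj_apply]
  group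

end BinaryTree
open BinaryTree in
theorem theorem4p4p1 (r : ℕ) (hr : 1 ≤ r) (a' b' : ℕ → W)
    (ha_one : IsConj (a' 1) σ)
    (ha_special : IsConj (a' (r + 1)) (pair (a' r) (b' r)))
    (ha_other : ∀ i, 1 < i → i ≠ r + 1 → IsConj (a' i) (pair (a' (i - 1)) 1))
    (hb_one : IsConj (b' 1) σ)
    (hb_other : ∀ j, 1 < j → j ≤ r → IsConj (b' j) (pair (b' (j - 1)) 1))
    (hprod : ∃ ord : LinearOrder (GenIndex r), HasOrderedProd ord (genFamily r a' b') 1) :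
    (∃ w : W,
      (∀ i, 1 ≤ i → ConjUnder (G r hr) (w⁻¹ * a' i * w) (stdA r hr i)) ∧
      (∀ j, 1 ≤ j → j ≤ r → ConjUnder (G r hr) (w⁻¹ * b' j * w) (stdB r hr j))) ∧
    ∀ w : W,
      (∀ i, 1 ≤ i → ConjUnder (G r hr) (w⁻¹ * a' i * w) (stdA r hr i)) →
      (∀ j, 1 ≤ j → j ≤ r → ConjUnder (G r hr) (w⁻¹ * b' j * w) (stdB r hr j)) →
      closedSubgroupGen r a' b' = (G r hr).map (MulAut.conj w).toMonoidHom := by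
  have hc : IsConjFamily hr (genFamily r a' b') := by
    refine ⟨fun x hx => ?_, fun x hx => ?_⟩
    · rcases (GenIndex.left_eq_none_iff hr x).1 hx with rfl | rfl
      · exact ha_one
      · exact hb_one
    · cases x with
      | a i hi =>
        have hi1 : 1 < i := by
          by_contra h
          exact hx (by simp [GenIndex.left, h])
        by_cases h : i = r + 1
        · subst h
          simpa [GenIndex.left, GenIndex.right, hi1, genFamily,
            show 0 < r by omega] using ha_special
        · simpa [GenIndex.left, GenIndex.right, hi1, genFamily, h] using ha_other i hi1 h
      | b j hj hjr =>
        have hj1 : 1 < j := by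
          by_contra h
          exact hx (by simp [GenIndex.left, h])
        simpa [GenIndex.left, GenIndex.right, hj1, genFamily] using hb_other j hj1 hjr
  refine ⟨?_, fun w ha hb => closedSubgroupGen_eq_map_conj hr fun x => ?_⟩
  · obtain ⟨w, hw⟩ := exists_conjUnder_std hr hc hprod
    exact ⟨w, fun i hi => hw (.a i hi), fun j hj hjr => hw (.b j hj hjr)⟩
  · cases x with
    | a i hi => exact ha i hi
    | b j hj hjr => exact hb j hj hjr
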